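/- Conventions. For a topological group $G$, a *$G$-flow* is a compact Hausdorff space with a continuous (left) action of $G$. A *$G$-map* between $G$-flows is a continuous equivariant map; an *extension* is a surjective $G$-map, and an *isomorphism* ($\simeq$) is a bijective $G$-map. A *subflow* is a nonempty closed $G$-invariant subset. An extension $\phi\colon Y\to X$ is *$G$-irreducible* if $\phi(Z)\neq X$ for every proper subflow $Z\subsetneq Y$. A *$G$-projective cover* of $X$ is a pair $(Y,\phi)$ where $\phi\colon Y\to X$ is a $G$-irreducible extension such that for every $G$-irreducible extension $\pi\colon Z\to X$ there is a $G$-map $\psi\colon Y\to Z$ with $\pi\circ\psi=\phi$; when $Y$ carries such a $\phi$ we write $\operatorname{Proj}_G(X)\simeq Y$. The *universal minimal flow* $M(G)$ is the (nonempty) minimal $G$-flow that is an extension of every minimal $G$-flow. The group $G$ is *extremely amenable* if every nonempty $G$-flow has a fixed point. For a closed subgroup $H\le G$, $\mathrm{Sa}(G/H)$ denotes the *Samuel compactification* of $G/H$: the Gelfand spectrum of the $C^*$-algebra of bounded functions $f\colon G/H\to\mathbb C$ that are right uniformly continuous (for every $\varepsilon>0$ there is a neighbourhood $U$ of $1_G$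 with $|f(ugH)-f(gH)|<\varepsilon$ for all $u\in U$, $g\in G$), with $G$ acting by $(g\cdot\chi)(f)=\chi\bigl(y\mapsto f(gy)\bigr)$. Theorem. Let $G$ be a Polish group, $X$ a $G$-flow, and $x\in X$ a point whose orbit $G\cdot x$ is comeager in $X$. Put $H=\operatorname{Stab}(x)$ and suppose that the universal minimal flow $M(H)$ of $H$ has a comeager orbit. Then there is an extremely amenable closed subgroup $H^*\le H$ with $M(H)\simeq \mathrm{Sa}(H/H^*)$ (an isomorphism of $H$-flows), and for every such $H^*$ one has $$\operatorname{Proj}_G(X)\simeq \mathrm{Sa}(G/H^*),$$ that is, there is a $G$-map $\phi\colon \mathrm{Sa}(G/H^*)\to X$ such that $(\mathrm{Sa}(G/H^*),\phi)$ is a $G$-projective cover of $X$. -/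

import Mathlib

open Topology MulAction
open scoped BoundedContinuousFunction

universe u v m w

noncomputable section

/-! ### Flows

A `G`-flow is a compact Hausdorff space `X` with a continuous action of `G`, that is
`[TopologicalSpace X] [CompactSpace X] [T2Space X] [MulAction G X] [ContinuousSMul G X]`. -/

/-- A `G`-map: a continuous equivariant map. -/
structure IsGMap (G : Type*) {X Y : Type*} [Group G]
    [TopologicalSpace X] [MulAction G X] [TopologicalSpace Y] [MulAction G Y]
    (f : X → Y) : Prop where
  continuous : Continuous f
  map_smul : ∀ (g : G) (x : X), f (g • x) = g • f x

/-- An extension: a surjective `G`-map. -/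
structure IsGExtension (G : Type*) {X Y : Type*} [Group G]
    [TopologicalSpace X] [MulAction G X] [TopologicalSpace Y] [MulAction G Y]
    (f : X → Y) : Prop extends IsGMap G f where
  surjective : Function.Surjective f

/-- Two flows are isomorphic if there is a bijective `G`-map between them. -/
def FlowIsomorphic (G X Y : Type*) [Group G]
    [TopologicalSpace X] [MulAction G X] [TopologicalSpace Y] [MulAction G Y] : Prop :=
  ∃ f : X → Y, IsGMap G f ∧ Function.Bijective f

/-- A subflow: a nonempty closed invariant subset. -/
structure IsSubflow (G : Type*) {X : Type*} [Group G] [TopologicalSpace X] [MulAction G X]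
    (Z : Set X) : Prop where
  nonempty : Z.Nonempty
  isClosed : IsClosed Z
  smul_mem : ∀ (g : G), ∀ z ∈ Z, g • z ∈ Z

/-- A `G`-irreducible extension: no proper subflow of `X` is mapped onto `Y`. -/
structure IsGIrreducible (G : Type*) {X Y : Type*} [Group G]
    [TopologicalSpace X] [MulAction G X] [TopologicalSpace Y] [MulAction G Y]
    (f : X → Y) : Prop extends IsGExtension G f where
  image_ne_univ : ∀ Z : Set X, IsSubflow G Z → Z ≠ Set.univ → f '' Z ≠ Set.univ

/-- `(Y, φ)` is a `G`-projective cover of the flow `X`: `φ` is a `G`-irreducible extension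
which factors through every `G`-irreducible extension of `X` (by a flow in the universe `w`). -/
structure IsGProjectiveCover (G : Type u) {X : Type v} {Y : Type m} [Group G]
    [TopologicalSpace G]
    [TopologicalSpace X] [MulAction G X] [TopologicalSpace Y] [MulAction G Y]
    (φ : Y → X) : Prop extends IsGIrreducible G φ where
  exists_lift : ∀ (Z : Type w) [TopologicalSpace Z] [CompactSpace Z] [T2Space Z]
    [MulAction G Z] [ContinuousSMul G Z] (π : Z → X), IsGIrreducible G π →
      ∃ ψ : Y → Z, IsGMap G ψ ∧ π ∘ ψ = φ

/-- The flow `M` is the universal minimal flow of `G`: it is minimal, and it is an extension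
of every minimal `G`-flow. (Every minimal `G`-flow is, up to isomorphism, a quotient of the Samuel
compactification of `G`, so it suffices to test on flows in the universe of `G`.) -/
structure IsUniversalMinimalFlow (G : Type u) (M : Type m) [Group G] [TopologicalSpace G]
    [TopologicalSpace M] [MulAction G M] : Prop where
  nonempty : Nonempty M
  isMinimal : MulAction.IsMinimal G M
  universal : ∀ (Y : Type u) [TopologicalSpace Y] [CompactSpace Y] [T2Space Y] [Nonempty Y]
    [MulAction G Y] [ContinuousSMul G Y] [MulAction.IsMinimal G Y],
      ∃ f : M → Y, IsGExtension G f

/-- `G` is extremely amenable: every nonempty `G`-flow has a fixed point. (It suffices to test on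
flows in the universe of `G`, as every nonempty `G`-flow receives a `G`-map from the Samuel
compactification of `G`.) -/
def ExtremelyAmenable (G : Type u) [Group G] [TopologicalSpace G] : Prop :=
  ∀ (Y : Type u) [TopologicalSpace Y] [CompactSpace Y] [T2Space Y] [Nonempty Y]
    [MulAction G Y] [ContinuousSMul G Y], (fixedPoints G Y).Nonempty

/-! ### The Samuel compactification of `G ⧸ H` -/

/-- Joint continuity of evaluation on the spectrum of a commutative Banach algebra. -/
theorem continuous_characterSpace_eval {T A : Type*} [TopologicalSpace T] [NormedCommRing A]
    [NormedAlgebra ℂ A] [NormOneClass A] [CompleteSpace A] {F : T → A} (hF : Continuous F) :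
    Continuous fun p : T × WeakDual.characterSpace ℂ A => p.2 (F p.1) := by
  refine continuous_iff_continuousAt.2 fun q => Metric.tendsto_nhds.2 fun ε hε => ?_
  have h1 : ∀ᶠ p : T × WeakDual.characterSpace ℂ A in 𝓝 q, dist (F p.1) (F q.1) < ε / 2 :=
    (hF.comp continuous_fst).continuousAt.eventually (Metric.ball_mem_nhds _ (half_pos hε))
  have hev : Continuous fun p : T × WeakDual.characterSpace ℂ A => p.2 (F q.1) :=
    (WeakDual.eval_continuous (F q.1)).comp (continuous_subtype_val.comp continuous_snd)
  have h2 : ∀ᶠ p : T × WeakDual.characterSpace ℂ A in 𝓝 q,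
      dist (p.2 (F q.1)) (q.2 (F q.1)) < ε / 2 :=
    hev.continuousAt.eventually (Metric.ball_mem_nhds _ (half_pos hε))
  filter_upwards [h1, h2] with p hp1 hp2
  have h3 : dist (p.2 (F p.1)) (p.2 (F q.1)) ≤ dist (F p.1) (F q.1) := by
    rw [dist_eq_norm, dist_eq_norm, ← map_sub]
    exact AlgHom.norm_apply_le_self p.2 (F p.1 - F q.1)
  linarith [dist_triangle (p.2 (F p.1)) (p.2 (F q.1)) (q.2 (F q.1))]

section Samuel

variable {G : Type u} [Group G] [TopologicalSpace G]

/-- The `C⋆`-algebra of bounded right uniformly continuous functions on `G ⧸ H`: for every `ε`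
there is a neighbourhood `U` of `1` with `‖f (u g H) - f (g H)‖ < ε` for all `u ∈ U`, `g ∈ G`. -/
def RUC (H : Subgroup G) : StarSubalgebra ℂ ((G ⧸ H) →ᵇ ℂ) where
  carrier := {f | ∀ ε > 0, ∃ U ∈ 𝓝 (1 : G), ∀ u ∈ U, ∀ y : G ⧸ H, ‖f (u • y) - f y‖ < ε}
  algebraMap_mem' c ε hε := ⟨Set.univ, Filter.univ_mem, fun u _ y => by
    simpa [BoundedContinuousFunction.algebraMap_apply] using hε⟩
  add_mem' {f g} hf hg ε hε := by
    obtain ⟨U, hU, hfU⟩ := hf (ε / 2) (by positivity)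
    obtain ⟨V, hV, hgV⟩ := hg (ε / 2) (by positivity)
    refine ⟨U ∩ V, Filter.inter_mem hU hV, fun u hu y => ?_⟩
    calc ‖(f + g) (u • y) - (f + g) y‖ = ‖(f (u • y) - f y) + (g (u • y) - g y)‖ := by
          congr 1; simp only [BoundedContinuousFunction.coe_add, Pi.add_apply]; ring
      _ ≤ ‖f (u • y) - f y‖ + ‖g (u • y) - g y‖ := norm_add_le _ _
      _ < ε := by linarith [hfU u hu.1 y, hgV u hu.2 y]
  mul_mem' {f g} hf hg ε hε := by
    obtain ⟨U, hU, hfU⟩ := hf (ε / (2 * (‖g‖ + 1))) (by positivity)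
    obtain ⟨V, hV, hgV⟩ := hg (ε / (2 * (‖f‖ + 1))) (by positivity)
    refine ⟨U ∩ V, Filter.inter_mem hU hV, fun u hu y => ?_⟩
    have h1 := hfU u hu.1 y
    have h2 := hgV u hu.2 y
    have h3 : ‖g (u • y)‖ ≤ ‖g‖ + 1 := (g.norm_coe_le_norm _).trans (by linarith)
    have h4 : ‖f y‖ ≤ ‖f‖ + 1 := (f.norm_coe_le_norm _).trans (by linarith)
    rw [lt_div_iff₀ (by positivity)] at h1 h2
    calc ‖(f * g) (u • y) - (f * g) y‖
          = ‖(f (u • y) - f y) * g (u • y) + f y * (g (u • y) - g y)‖ := by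
          congr 1; simp only [BoundedContinuousFunction.coe_mul, Pi.mul_apply]; ring
      _ ≤ ‖f (u • y) - f y‖ * ‖g (u • y)‖ + ‖f y‖ * ‖g (u • y) - g y‖ := by
          simpa only [norm_mul] using norm_add_le ((f (u • y) - f y) * g (u • y))
            (f y * (g (u • y) - g y))
      _ ≤ ‖f (u • y) - f y‖ * (‖g‖ + 1) + (‖f‖ + 1) * ‖g (u • y) - g y‖ := by gcongr
      _ < ε := by linarith
  star_mem' {f} hf ε hε := by
    obtain ⟨U, hU, hfU⟩ := hf ε hε
    refine ⟨U, hU, fun u hu y => ?_⟩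
    simpa only [BoundedContinuousFunction.star_apply, ← star_sub, norm_star] using hfU u hu y

theorem RUC.isClosed (H : Subgroup G) : IsClosed (RUC H : Set ((G ⧸ H) →ᵇ ℂ)) := by
  refine isClosed_of_closure_subset fun f hf ε hε => ?_
  obtain ⟨g, hg, hfg⟩ := Metric.mem_closure_iff.1 hf (ε / 3) (by positivity)
  obtain ⟨U, hU, hgU⟩ := hg (ε / 3) (by positivity)
  refine ⟨U, hU, fun u hu y => ?_⟩
  have h1 := (BoundedContinuousFunction.dist_coe_le_dist (f := f) (g := g) (u • y)).trans_lt hfg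
  have h2 := (BoundedContinuousFunction.dist_coe_le_dist (f := f) (g := g) y).trans_lt hfg
  have h3 := hgU u hu y
  rw [← dist_eq_norm] at h3 ⊢
  have h4 := dist_triangle4 (f (u • y)) (g (u • y)) (g y) (f y)
  rw [dist_comm (g y)] at h4
  linarith

instance (H : Subgroup G) : CompleteSpace (RUC H) :=
  (RUC.isClosed H).completeSpace_coe

variable [IsTopologicalGroup G]

/-- Left translation `f ↦ (y ↦ f (g • y))` on right uniformly continuous functions. -/
def RUC.translate (H : Subgroup G) (g : G) : RUC H →⋆ₐ[ℂ] RUC H where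
  toFun f := ⟨f.1.compContinuous ⟨fun y => g • y, continuous_const_smul g⟩, fun ε hε => by
    obtain ⟨U, hU, hfU⟩ := f.2 ε hε
    have hc : Filter.Tendsto (fun u : G => g * u * g⁻¹) (𝓝 1) (𝓝 1) := by
      have : Continuous fun u : G => g * u * g⁻¹ := by fun_prop
      simpa using this.tendsto 1
    refine ⟨_, hc hU, fun u hu y => ?_⟩
    simpa [smul_smul] using hfU _ hu (g • y)⟩
  map_one' := rfl
  map_mul' _ _ := rfl
  map_zero' := rfl
  map_add' _ _ := rfl
  commutes' _ := rfl
  map_star' _ := rfl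

/-- The Samuel compactification of `G ⧸ H`: the Gelfand spectrum (with the weak-⋆ topology) of the
algebra of bounded right uniformly continuous functions on `G ⧸ H`. -/
def Samuel (H : Subgroup G) : Type u := WeakDual.characterSpace ℂ (RUC H)

namespace Samuel

variable (H : Subgroup G)

instance : TopologicalSpace (Samuel H) :=
  inferInstanceAs (TopologicalSpace (WeakDual.characterSpace ℂ (RUC H)))

instance : CompactSpace (Samuel H) :=
  inferInstanceAs (CompactSpace (WeakDual.characterSpace ℂ (RUC H)))

instance : T2Space (Samuel H) :=
  inferInstanceAs (T2Space (WeakDual.characterSpace ℂ (RUC H)))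

/-- The action of `G` on the Samuel compactification, `(g • χ) f = χ (y ↦ f (g • y))`; it extends
the action of `G` on `G ⧸ H`. -/
instance : MulAction G (Samuel H) where
  smul g χ := WeakDual.CharacterSpace.compContinuousMap (RUC.translate H g) χ
  one_smul χ := by
    refine Subtype.ext (DFunLike.ext _ _ fun f => ?_)
    change χ.1 (RUC.translate H 1 f) = χ.1 f
    congr 1
    ext y
    exact congrArg f.1 (one_smul G y)
  mul_smul g h χ := by
    refine Subtype.ext (DFunLike.ext _ _ fun f => ?_)
    change χ.1 (RUC.translate H (g * h) f) = χ.1 (RUC.translate H h (RUC.translate H g f))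
    congr 1
    ext y
    exact congrArg f.1 (mul_smul g h y)

theorem continuous_translate (f : RUC H) : Continuous fun g : G => RUC.translate H g f := by
  refine continuous_iff_continuousAt.2 fun g => Metric.tendsto_nhds.2 fun ε hε => ?_
  obtain ⟨U, hU, hfU⟩ := f.2 (ε / 2) (by positivity)
  have hc : Filter.Tendsto (fun k : G => k * g⁻¹) (𝓝 g) (𝓝 1) := by
    have : Continuous fun k : G => k * g⁻¹ := by fun_prop
    simpa using this.tendsto g
  filter_upwards [hc hU] with k hk
  refine lt_of_le_of_lt ?_ (half_lt_self hε)
  refine (BoundedContinuousFunction.dist_le (by positivity)).2 fun y => ?_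
  have := (hfU _ hk (g • y)).le
  rw [smul_smul, inv_mul_cancel_right, ← dist_eq_norm] at this
  exact this

instance : ContinuousSMul G (Samuel H) where
  continuous_smul :=
    Continuous.subtype_mk
      (WeakDual.continuous_of_continuous_eval fun f =>
        continuous_characterSpace_eval (continuous_translate H f)) _

end Samuel

end Samuel

end

noncomputable section

/-! Write `H` for the stabilizer of `x`. A `G`-map out of `Sa(G/K)` amounts to a point fixed by `K`,
namely the image of the trivial coset (`Samuel.exists_gMap`, `Samuel.gMap_ext`).

The main tool is an Effros type theorem: since the orbit of `x` is comeager, `U • x` contains a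
neighbourhood of `x` in the orbit for every neighbourhood `U` of `1`. Hence for `K ≤ H` the fibre
over `x` of the map `Sa(G/K) → X` lies in the closure of the cosets of elements of `H`
(`Samuel.mem_closure_of_apply_eq`), so in the image of `Sa(H/K)`. If `Sa(H/K)` is minimal, a subflow
of `Sa(G/K)` mapped onto `X` meets this image, so contains the trivial coset and is everything: the
map is irreducible. If `K` is extremely amenable, it fixes a point over `x` in every extension of
`X`, which yields the lift.

For the existence of `K`, let `K` be the stabilizer in `H` of a point `p` in the comeager orbit of
`M(H)`. The fibre theorem for `H` acting on `M(H)` makes `Sa(H/K)` minimal, and a map from a minimal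
flow to `M(H)` is injective, so the two flows are isomorphic. The same two facts, applied to a
minimal subflow of `Sa(H)`, give a point over `p` fixed by `K` and in the closure of `K`; this
forces extreme amenability. -/

theorem IsGMap.comp {G X Y Z : Type*} [Group G]
    [TopologicalSpace X] [MulAction G X] [TopologicalSpace Y] [MulAction G Y]
    [TopologicalSpace Z] [MulAction G Z] {f : Y → Z} {g : X → Y} (hf : IsGMap G f)
    (hg : IsGMap G g) : IsGMap G (f ∘ g) :=
  ⟨hf.continuous.comp hg.continuous, fun a x => by simp [hg.map_smul, hf.map_smul]⟩

theorem IsGMap.restrict {G X Y : Type*} [Group G] (H : Subgroup G)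
    [TopologicalSpace X] [MulAction G X] [TopologicalSpace Y] [MulAction G Y]
    {f : X → Y} (hf : IsGMap G f) : IsGMap H f :=
  ⟨hf.continuous, fun a x => hf.map_smul a x⟩

/-- A continuous function on a flow is uniformly close to its translates by group elements
near the identity. -/
theorem exists_nhds_one_norm_smul_sub_lt {G Y E : Type*} [Group G] [TopologicalSpace G]
    [TopologicalSpace Y] [CompactSpace Y] [MulAction G Y] [ContinuousSMul G Y]
    [SeminormedAddCommGroup E] {f : Y → E} (hf : Continuous f) {ε : ℝ} (hε : 0 < ε) :
    ∃ U ∈ 𝓝 (1 : G), ∀ u ∈ U, ∀ y, ‖f (u • y) - f y‖ < ε := by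
  have hc : Continuous fun p : G × Y => ‖f (p.1 • p.2) - f p.2‖ := by fun_prop
  have hopen : IsOpen {p : G × Y | ‖f (p.1 • p.2) - f p.2‖ < ε} :=
    isOpen_lt hc continuous_const
  obtain ⟨U, V, hU, -, h1, hV, hUV⟩ := generalized_tube_lemma (s := {(1 : G)})
    (t := (Set.univ : Set Y)) isCompact_singleton isCompact_univ hopen (by
      rintro ⟨a, y⟩ ⟨rfl, -⟩
      simpa using hε)
  exact ⟨U, hU.mem_nhds (h1 rfl), fun u hu y => hUV (Set.mk_mem_prod hu (hV (Set.mem_univ y)))⟩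

/-! ### Points, density and the mapping property of the Samuel compactification. -/

namespace Samuel

section

variable {G : Type u} [Group G] [TopologicalSpace G] {H : Subgroup G}

/-- Evaluation of a point of the Samuel compactification at a right uniformly continuous
function. -/
def eval (f : RUC H) (χ : Samuel H) : ℂ := χ.1 f

variable (H) in
/-- The canonical map of `G ⧸ H` to its Samuel compactification. -/
def of (y : G ⧸ H) : Samuel H :=
  WeakDual.CharacterSpace.equivAlgHom.symm
    { toFun := fun f : RUC H => f.1 y
      map_one' := rfl
      map_mul' := fun _ _ => rfl
      map_zero' := rfl
      map_add' := fun _ _ => rfl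
      commutes' := fun _ => rfl }

theorem eval_of (f : RUC H) (y : G ⧸ H) : eval f (of H y) = f.1 y := rfl

theorem continuous_eval (f : RUC H) : Continuous (eval f) :=
  (WeakDual.eval_continuous f).comp continuous_subtype_val

theorem continuous_of : Continuous (of H) := by
  refine Continuous.subtype_mk (WeakDual.continuous_of_continuous_eval fun f => ?_) _
  exact f.1.continuous

section orbitMap

variable {Y : Type*} [TopologicalSpace Y] [MulAction G Y]
  [ContinuousSMul G Y]

/-- The orbit map of a point fixed by `H`, on `G ⧸ H`. -/
def orbitMap (y : Y) (hy : H ≤ stabilizer G y) : C(G ⧸ H, Y) where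
  toFun q := Quotient.liftOn' q (fun g => g • y) fun a b hab => by
    have := hy (QuotientGroup.leftRel_apply.1 hab)
    rw [mem_stabilizer_iff, mul_smul, inv_smul_eq_iff] at this
    exact this.symm
  continuous_toFun := (continuous_id.smul continuous_const).quotient_liftOn' _

theorem orbitMap_smul (y : Y) (hy : H ≤ stabilizer G y) (g : G) (q : G ⧸ H) :
    orbitMap y hy (g • q) = g • orbitMap y hy q := by
  induction q using QuotientGroup.induction_on with
  | H a => exact mul_smul g a y

end orbitMap

/-- By Gelfand duality a continuous function on the spectrum is evaluation at some element of the
algebra; if it vanishes on all cosets, that element is zero. -/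
theorem denseRange_of : DenseRange (of H) := by
  by_contra hd
  obtain ⟨χ, hχ⟩ : ∃ χ, χ ∉ closure (Set.range (of H)) := by
    simpa [DenseRange, Dense] using hd
  obtain ⟨f, hf0, hf1, -⟩ := exists_continuous_zero_one_of_isClosed
    (isClosed_closure (s := Set.range (of H))) (isClosed_singleton (x := χ))
    (Set.disjoint_singleton_right.2 hχ)
  have : IsClosed (RUC H : Set ((G ⧸ H) →ᵇ ℂ)) := RUC.isClosed H
  let F : C(WeakDual.characterSpace ℂ (RUC H), ℂ) :=
    ⟨fun χ => ((f χ : ℝ) : ℂ), Complex.continuous_ofReal.comp f.continuous⟩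
  obtain ⟨a, ha⟩ := (gelfandTransform_bijective (RUC H)).2 F
  have hev : ∀ ψ : Samuel H, eval a ψ = ((f ψ : ℝ) : ℂ) := fun ψ => DFunLike.congr_fun ha ψ
  have ha0 : a = 0 := by
    refine Subtype.ext (BoundedContinuousFunction.ext fun y => ?_)
    have h := hev (of H y)
    rw [eval_of, hf0 (subset_closure ⟨y, rfl⟩)] at h
    simpa using h
  have h1 := hev χ
  rw [hf1 rfl, ha0] at h1
  have : eval (0 : RUC H) χ = 0 := map_zero (show WeakDual.characterSpace ℂ (RUC H) from χ)
  rw [this] at h1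
  simp at h1

variable [IsTopologicalGroup G]

theorem smul_of (g : G) (y : G ⧸ H) : g • of H y = of H (g • y) := rfl

theorem dense_orbit_of : Dense (orbit G (of H (1 : G))) := by
  refine denseRange_of.mono ?_
  rintro _ ⟨y, rfl⟩
  induction y using QuotientGroup.induction_on with
  | H g => exact ⟨g, by simp [smul_of]⟩

instance : Nonempty (Samuel H) := ⟨of H (1 : G)⟩

/-- `G`-maps on the Samuel compactification of `G ⧸ H` that agree at the trivial coset agree. -/
theorem gMap_ext {Y : Type*} [TopologicalSpace Y] [T2Space Y] [MulAction G Y]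
    {f g : Samuel H → Y} (hf : IsGMap G f) (hg : IsGMap G g)
    (h : f (of H (1 : G)) = g (of H (1 : G))) : f = g := by
  refine Continuous.ext_on dense_orbit_of hf.continuous hg.continuous ?_
  rintro _ ⟨a, rfl⟩
  simp only [hf.map_smul, hg.map_smul, h]

section lift

variable {Y : Type*} [TopologicalSpace Y] [CompactSpace Y] [MulAction G Y]
  [ContinuousSMul G Y]

/-- Continuous functions on a flow, pulled back along an orbit map. -/
def pullback (y : Y) (hy : H ≤ stabilizer G y) : C(Y, ℂ) →⋆ₐ[ℂ] RUC H where
  toFun f := ⟨(BoundedContinuousFunction.mkOfCompact f).compContinuous (orbitMap y hy),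
    fun ε hε => by
      obtain ⟨U, hU, h⟩ := exists_nhds_one_norm_smul_sub_lt (G := G) f.continuous hε
      refine ⟨U, hU, fun u hu q => ?_⟩
      simpa [orbitMap_smul] using h u hu (orbitMap y hy q)⟩
  map_one' := rfl
  map_mul' _ _ := rfl
  map_zero' := rfl
  map_add' _ _ := rfl
  commutes' _ := rfl
  map_star' _ := rfl

/-- The orbit map of a point fixed by `H` extends to the Samuel compactification of `G ⧸ H`. -/
theorem exists_gMap [T2Space Y] (y : Y) (hy : H ≤ stabilizer G y) :
    ∃ Φ : Samuel H → Y, IsGMap G Φ ∧ Φ (of H (1 : G)) = y := by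
  let Φ : Samuel H → Y := fun χ => (WeakDual.CharacterSpace.homeoEval Y ℂ).symm
    (WeakDual.CharacterSpace.compContinuousMap (pullback y hy) χ)
  have hc : Continuous Φ := (Homeomorph.continuous _).comp (ContinuousMap.continuous _)
  have hof : ∀ q, Φ (of H q) = orbitMap y hy q := fun q =>
    (Homeomorph.symm_apply_eq _).2 rfl
  refine ⟨Φ, ⟨hc, fun g => ?_⟩, ?_⟩
  · refine congrFun (denseRange_of.equalizer (hc.comp (continuous_const_smul g))
      (hc.const_smul g) (funext fun q => ?_))
    simp only [Function.comp, smul_of, hof, orbitMap_smul]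
  · rw [hof]
    exact one_smul G y

end lift

end

end Samuel

/-! ### Comeager orbits and the Effros theorem. -/

section Effros

variable {G X : Type*} [Group G] [TopologicalSpace G] [TopologicalSpace X]
  [MulAction G X] [ContinuousSMul G X]

open scoped Pointwise in
theorem smul_mem_interior_closure_image {x y : X} {U : Set G}
    (h : y ∈ interior (closure ((fun g : G => g • x) '' U))) (a : G) :
    a • y ∈ interior (closure ((fun g : G => g • x) '' (a • U))) := by
  have : (fun g : G => g • x) '' (a • U) = a • ((fun g : G => g • x) '' U) := by
    simp only [← Set.image_smul, Set.image_image, smul_eq_mul, mul_smul]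
  rw [this, closure_smul, interior_smul]
  exact Set.smul_mem_smul_set h

variable [IsTopologicalGroup G]

open scoped Pointwise in
/-- If the orbit of `x` is comeager then neighbourhoods of the identity move `x` onto somewhere
dense sets around `x`. -/
theorem mem_interior_closure_image_smul [SecondCountableTopology G] [BaireSpace X] {x : X}
    (hx : orbit G x ∈ residual X) {U : Set G} (hU : U ∈ 𝓝 1) :
    x ∈ interior (closure ((fun g : G => g • x) '' U)) := by
  obtain ⟨V, hV, -, hVinv, hVU⟩ := exists_closed_nhds_one_inv_eq_mul_subset hU
  have hne : (interior (closure ((fun g : G => g • x) '' V))).Nonempty := by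
    by_contra hemp
    rw [Set.not_nonempty_iff_eq_empty] at hemp
    -- Translates of `V` by a dense sequence cover `G`; if `V • x` were nowhere dense, the comeager
    -- orbit would be meager.
    have hres : ∀ n, (closure ((fun g : G => g • x) '' (TopologicalSpace.denseSeq G n • V)))ᶜ ∈
        residual X := by
      refine fun n => residual_of_dense_open isClosed_closure.isOpen_compl ?_
      rw [← interior_eq_empty_iff_dense_compl, Set.eq_empty_iff_forall_notMem]
      intro y hy
      have := smul_mem_interior_closure_image hy (TopologicalSpace.denseSeq G n)⁻¹
      rw [inv_smul_smul, hemp] at this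
      exact this
    have : Nonempty X := ⟨x⟩
    obtain ⟨-, ⟨g, rfl⟩, hg⟩ :=
      (dense_of_mem_residual (Filter.inter_mem hx (countable_iInter_mem.2 hres))).nonempty
    obtain ⟨n, hn⟩ := (TopologicalSpace.denseRange_denseSeq G).exists_mem_open
      (isOpen_interior (s := g • V))
      ⟨g, mem_interior_iff_mem_nhds.2 (by simpa using smul_mem_nhds_smul g hV)⟩
    obtain ⟨v, hv, hvn⟩ := interior_subset hn
    refine Set.mem_iInter.1 hg n (subset_closure ⟨g, ?_, rfl⟩)
    refine ⟨v⁻¹, by rwa [← hVinv, Set.inv_mem_inv], ?_⟩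
    simp only [smul_eq_mul] at hvn ⊢
    rw [← hvn, mul_inv_cancel_right]
  obtain ⟨y, hy, v, hv, rfl⟩ :=
    mem_closure_iff.1 (interior_subset hne.some_mem) _ isOpen_interior hne.some_mem
  have := smul_mem_interior_closure_image hy v⁻¹
  simp only [inv_smul_smul] at this
  refine interior_mono (closure_mono (Set.image_mono ?_)) this
  rintro _ ⟨w, hw, rfl⟩
  exact hVU (Set.mul_mem_mul (by rwa [← hVinv, Set.inv_mem_inv]) hw)

open scoped Pointwise in
/-- An Effros type theorem: orbit maps that are almost open at the identity are open onto the
orbit. -/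
theorem exists_nhds_forall_smul_mem_imp [PolishSpace G] [RegularSpace X] [T2Space X] {x : X}
    (h : ∀ U ∈ 𝓝 (1 : G), x ∈ interior (closure ((fun g : G => g • x) '' U)))
    {U : Set G} (hU : U ∈ 𝓝 1) :
    ∃ W ∈ 𝓝 x, ∀ g : G, g • x ∈ W → ∃ u ∈ U, u • x = g • x := by
  let := TopologicalSpace.upgradeIsCompletelyMetrizable G
  let I (a : G) (r : ℝ) : Set X :=
    interior (closure ((fun g : G => g • x) '' Metric.ball a r))
  have hI : ∀ (a : G) {r : ℝ}, 0 < r → a • x ∈ I a r := by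
    intro a r hr
    have h1 : a⁻¹ • Metric.ball a r ∈ 𝓝 (1 : G) := by
      simpa using smul_mem_nhds_smul a⁻¹ (Metric.ball_mem_nhds a hr)
    simpa using smul_mem_interior_closure_image (h _ h1) a
  -- Back and forth: `a'` is chosen near `a` with `a' • x ∈ I b s`, then `b'` near `b` with `b' • x
  -- ∈ I a' (r / 2)`. Iterating from `(1, g)` gives limits `a`, `b` with `a • x = b • x`, and `g *
  -- b⁻¹ * a` is the required element of `U`.
  have step : ∀ (a b : G) (r s : ℝ), 0 < r → 0 < s → b • x ∈ I a r →
      ∃ a' b' : G, dist a a' ≤ r ∧ dist b b' ≤ s ∧ b' • x ∈ I a' (r / 2) := by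
    intro a b r s hr hs hb
    obtain ⟨y, ⟨hya, hyb⟩, a', ha', rfl⟩ := mem_closure_iff.1 (interior_subset hb) _
      (isOpen_interior.inter isOpen_interior) ⟨hb, hI b hs⟩
    obtain ⟨y, hy, b', hb', rfl⟩ := mem_closure_iff.1 (interior_subset hyb) _
      isOpen_interior (hI a' (half_pos hr))
    exact ⟨a', b', (Metric.mem_ball'.1 ha').le, (Metric.mem_ball'.1 hb').le, hy⟩
  obtain ⟨V, hV, -, -, hVU⟩ := exists_closed_nhds_one_inv_eq_mul_subset hU
  obtain ⟨r, hr, hrV⟩ := Metric.nhds_basis_closedBall.mem_iff.1 hV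
  -- The successive moves `r / 2 / 2 ^ n` add up to `r`, so the limit stays in the closed ball
  -- inside `V`.
  refine ⟨I 1 (r / 2), isOpen_interior.mem_nhds (by simpa using hI 1 (half_pos hr)),
    fun g hg => ?_⟩
  have hVg : {b : G | g * b⁻¹ ∈ V} ∈ 𝓝 g := by
    have : Continuous fun b : G => g * b⁻¹ := by fun_prop
    exact this.continuousAt.preimage_mem_nhds (by simpa using hV)
  obtain ⟨s, hs, hsV⟩ := Metric.nhds_basis_closedBall.mem_iff.1 hVg
  have hpow : ∀ {t : ℝ}, 0 < t → ∀ n : ℕ, 0 < t / 2 / 2 ^ n := fun ht n => by positivity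
  choose! A B hA hB hAB using step
  let P (n : ℕ) : Type _ := {p : G × G // p.2 • x ∈ I p.1 (r / 2 / 2 ^ n)}
  let S (n : ℕ) : P n := Nat.rec ⟨(1, g), by simpa using hg⟩ (fun n p =>
    ⟨(A p.1.1 p.1.2 (r / 2 / 2 ^ n) (s / 2 / 2 ^ n), B p.1.1 p.1.2 (r / 2 / 2 ^ n) (s / 2 / 2 ^ n)),
      by simpa only [pow_succ, div_div, mul_assoc] using hAB _ _ _ _ (hpow hr n) (hpow hs n) p.2⟩) n
  have hSA : ∀ n, dist (S n).1.1 (S (n + 1)).1.1 ≤ r / 2 / 2 ^ n := fun n =>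
    hA _ _ _ _ (hpow hr n) (hpow hs n) (S n).2
  have hSB : ∀ n, dist (S n).1.2 (S (n + 1)).1.2 ≤ s / 2 / 2 ^ n := fun n =>
    hB _ _ _ _ (hpow hr n) (hpow hs n) (S n).2
  obtain ⟨a, ha⟩ := cauchySeq_tendsto_of_complete (cauchySeq_of_le_geometric_two hSA)
  obtain ⟨b, hb⟩ := cauchySeq_tendsto_of_complete (cauchySeq_of_le_geometric_two hSB)
  have haV : a ∈ V := hrV (by
    rw [Metric.mem_closedBall']
    exact dist_le_of_le_geometric_two_of_tendsto₀ hSA ha)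
  have hbV : g * b⁻¹ ∈ V := hsV (by
    rw [Metric.mem_closedBall']
    exact dist_le_of_le_geometric_two_of_tendsto₀ hSB hb)
  -- A closed neighbourhood `N` of `a • x` eventually contains the whole image of the shrinking
  -- balls, hence its closure, hence the points `b_n • x` and their limit.
  have hab : b • x = a • x := by
    by_contra hne
    obtain ⟨N, hN, hNc, hNb⟩ := exists_mem_nhds_isClosed_subset
      (isOpen_compl_singleton.mem_nhds (Ne.symm hne : a • x ≠ b • x))
    have hNa : (fun g : G => g • x) ⁻¹' N ∈ 𝓝 a :=
      (continuous_id.smul continuous_const).continuousAt.preimage_mem_nhds hN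
    obtain ⟨δ, hδ, hδN⟩ := Metric.nhds_basis_ball.mem_iff.1 hNa
    have hsmall : Filter.Tendsto (fun n : ℕ => r / 2 / 2 ^ n) Filter.atTop (𝓝 0) := by
      simpa [div_eq_mul_inv] using (tendsto_pow_atTop_nhds_zero_of_lt_one (r := (2 : ℝ)⁻¹)
        (by norm_num) (by norm_num)).const_mul (r / 2)
    have hev : ∀ᶠ n in Filter.atTop, (S n).1.2 • x ∈ N := by
      filter_upwards [ha.eventually (Metric.ball_mem_nhds a (half_pos hδ)),
        hsmall.eventually (gt_mem_nhds (half_pos hδ))] with n hn1 hn2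
      refine closure_minimal ?_ hNc (interior_subset (S n).2)
      rintro _ ⟨c, hc, rfl⟩
      refine hδN (Metric.mem_ball.2 ?_)
      rw [Metric.mem_ball] at hc
      linarith [dist_triangle c (S n).1.1 a]
    exact hNb (hNc.mem_of_tendsto (hb.smul_const x) hev) rfl
  refine ⟨g * b⁻¹ * a, hVU (Set.mul_mem_mul hbV haV), ?_⟩
  rw [mul_smul, ← hab, mul_smul, inv_smul_smul]

end Effros

/-- Let `K` be a subgroup of the stabilizer of a point `x` with comeager orbit. The points of the
Samuel compactification of `G ⧸ K` over `x` belong to the closure of the image of the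
stabilizer. -/
theorem Samuel.mem_closure_of_apply_eq {G : Type u} [Group G] [TopologicalSpace G]
    [IsTopologicalGroup G] [PolishSpace G] {X : Type*} [TopologicalSpace X] [CompactSpace X]
    [T2Space X] [MulAction G X] [ContinuousSMul G X] {x : X} (hx : orbit G x ∈ residual X)
    {K : Subgroup G} {φ : Samuel K → X} (hφ : IsGMap G φ) (hφ1 : φ (of K (1 : G)) = x)
    {z : Samuel K} (hz : φ z = x) :
    z ∈ closure ((fun g : G => of K (g : G ⧸ K)) '' (stabilizer G x : Set G)) := by
  by_contra hzC
  obtain ⟨f, hf0, hf1, -⟩ := exists_continuous_zero_one_of_isClosed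
    isClosed_closure (isClosed_singleton (x := z)) (Set.disjoint_singleton_right.2 hzC)
  -- An orbit point `g • of K 1` near `z` has `g • x` near `x`, so `g • x = a • x` with `a ∈ U`.
  -- Then `a⁻¹ * g` stabilizes `x`, where `f` vanishes, and moving by `a` changes `f` by less than
  -- `1 / 2`.
  obtain ⟨U, hU, hfU⟩ := exists_nhds_one_norm_smul_sub_lt (G := G) f.continuous one_half_pos
  obtain ⟨W, hW, hWU⟩ := exists_nhds_forall_smul_mem_imp
    (fun U hU => mem_interior_closure_image_smul hx hU) hU
  have hN : ∀ᶠ q in 𝓝 z, φ q ∈ W ∧ 1 / 2 < f q := by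
    refine (hφ.continuous.continuousAt.eventually (by rwa [hz])).and
      (f.continuous.continuousAt.eventually (lt_mem_nhds ?_))
    rw [hf1 rfl]
    norm_num
  obtain ⟨_, ⟨g, rfl⟩, hgW, hgf⟩ := (mem_closure_iff_frequently.1
    (dense_orbit_of (H := K) z)).and_eventually hN |>.exists
  simp only [hφ.map_smul, hφ1] at hgW
  obtain ⟨a, ha, hag⟩ := hWU g hgW
  have hmem : of K ((a⁻¹ * g : G) : G ⧸ K) ∈
      (fun g : G => of K (g : G ⧸ K)) '' (stabilizer G x : Set G) :=
    ⟨a⁻¹ * g, by simp [mul_smul, ← hag], rfl⟩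
  have h0 := hf0 (subset_closure hmem)
  have h1 := hfU a ha (of K ((a⁻¹ * g : G) : G ⧸ K))
  have h2 : a • of K ((a⁻¹ * g : G) : G ⧸ K) = g • of K (1 : G) := by
    rw [smul_of, smul_of]
    congr 1
    change ((a * (a⁻¹ * g) : G) : G ⧸ K) = ((g * 1 : G) : G ⧸ K)
    simp
  rw [h0, h2] at h1
  simp only [Pi.zero_apply, sub_zero, Real.norm_eq_abs] at h1
  linarith [le_abs_self (f (g • of K (1 : G)))]

/-! ### Minimal subflows. -/

section Minimal

variable {G X : Type*} [Group G] [TopologicalSpace X] [MulAction G X]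

/-- Every nonempty compact flow contains a minimal subflow. -/
theorem exists_minimal_isSubflow [CompactSpace X] [Nonempty X] :
    ∃ N : Set X, Minimal (IsSubflow G) N := by
  refine zorn_superset {N | IsSubflow G N} fun c hc hchain => ?_
  rcases c.eq_empty_or_nonempty with rfl | hne
  · exact ⟨Set.univ, ⟨Set.univ_nonempty, isClosed_univ, fun _ _ _ => Set.mem_univ _⟩, by simp⟩
  · have := hne.to_subtype
    refine ⟨⋂₀ c, ⟨?_, isClosed_sInter fun s hs => (hc hs).isClosed, fun g z hz s hs =>
      (hc hs).smul_mem g z (hz s hs)⟩, fun s hs => Set.sInter_subset_of_mem hs⟩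
    exact IsCompact.nonempty_sInter_of_directed_nonempty_isCompact_isClosed
      (fun a ha b hb => (hchain.total ha hb).elim (fun h => ⟨a, ha, subset_rfl, h⟩)
        (fun h => ⟨b, hb, h, subset_rfl⟩)) (fun s hs => (hc hs).nonempty)
      (fun s hs => (hc hs).isClosed.isCompact) (fun s hs => (hc hs).isClosed)

/-- A subflow, as a `SubMulAction`. -/
def IsSubflow.toSubMulAction {N : Set X} (hN : IsSubflow G N) : SubMulAction G X where
  carrier := N
  smul_mem' g _ hz := hN.smul_mem g _ hz

theorem SubMulAction.isGMap_subtype (N : SubMulAction G X) :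
    IsGMap G (Subtype.val : N → X) :=
  ⟨continuous_subtype_val, fun _ _ => rfl⟩

theorem SubMulAction.continuousSMul [TopologicalSpace G] [ContinuousSMul G X]
    (N : SubMulAction G X) : ContinuousSMul G N where
  continuous_smul := Continuous.subtype_mk (by fun_prop) _

theorem isMinimal_of_minimal_isSubflow [ContinuousConstSMul G X] {N : SubMulAction G X}
    (hN : Minimal (IsSubflow G) (N : Set X)) : MulAction.IsMinimal G N := by
  have : ContinuousConstSMul G N := ⟨fun g => Continuous.subtype_mk (by fun_prop) _⟩
  refine (isMinimal_iff_isClosed_smul_invariant G).2 fun s hs hinv => ?_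
  rcases s.eq_empty_or_nonempty with rfl | hne
  · exact Or.inl rfl
  refine Or.inr (Set.eq_univ_of_forall fun z => ?_)
  have hsub : IsSubflow G (Subtype.val '' s) := by
    refine ⟨hne.image _, hN.prop.isClosed.isClosedMap_subtype_val _ hs, ?_⟩
    rintro g _ ⟨z, hz, rfl⟩
    exact ⟨g • z, hinv g ⟨z, hz, rfl⟩, rfl⟩
  obtain ⟨z', hz', h⟩ := hN.le_of_le hsub (by rintro _ ⟨z, -, rfl⟩; exact z.2) z.2
  rwa [← Subtype.ext h]

theorem IsGMap.surjective_of_isMinimal {Y : Type*} [TopologicalSpace Y] [MulAction G Y]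
    [CompactSpace X] [Nonempty X] [T2Space Y] [MulAction.IsMinimal G Y] {f : X → Y}
    (hf : IsGMap G f) : Function.Surjective f := by
  inhabit X
  have hd : DenseRange f := (MulAction.dense_orbit G (f default)).mono (by
    rintro _ ⟨g, rfl⟩
    exact ⟨g • default, hf.map_smul _ _⟩)
  have hcl := (isCompact_range hf.continuous).isClosed
  rw [← Set.range_eq_univ, ← hcl.closure_eq, hd.closure_eq]

end Minimal

/-! ### Retractions of the Samuel compactification and injectivity of maps to the universal minimal
flow. -/

namespace Samuel

variable (G : Type u) [Group G] [TopologicalSpace G] [IsTopologicalGroup G]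

/-- The Samuel compactification of `G` retracts onto a minimal subflow. -/
theorem exists_minimal_retraction :
    ∃ N : SubMulAction G (Samuel (⊥ : Subgroup G)),
      Minimal (IsSubflow G) (N : Set (Samuel (⊥ : Subgroup G))) ∧
      ∃ r : Samuel (⊥ : Subgroup G) → Samuel (⊥ : Subgroup G), IsGMap G r ∧ (∀ q, r q ∈ N) ∧
        ∀ q ∈ N, r q = q := by
  let S := Samuel (⊥ : Subgroup G)
  have hρ : ∀ q : S, ∃ Φ : S → S, IsGMap G Φ ∧ Φ (of ⊥ (1 : G)) = q := fun q =>
    exists_gMap q bot_le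
  choose ρ hρm hρ1 using hρ
  -- The Ellis semigroup structure: `ρ q` is right multiplication by `q`, so the product is
  -- continuous in its left variable.
  let _ : Semigroup S :=
    { mul := fun p q => ρ q p
      mul_assoc := fun p q r => by
        refine congrFun (gMap_ext ((hρm r).comp (hρm q)) (hρm (ρ r q)) ?_) p
        rw [Function.comp, hρ1, hρ1] }
  obtain ⟨N, hN⟩ := exists_minimal_isSubflow (G := G) (X := S)
  have hmem : ∀ p, ∀ q ∈ N, ρ q p ∈ N := by
    intro p q hq
    have hsub : Set.range (ρ q) ⊆ N := by
      refine (Continuous.range_subset_closure_image_dense (hρm q).continuous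
        (dense_orbit_of (H := (⊥ : Subgroup G)))).trans (closure_minimal ?_ hN.prop.isClosed)
      rintro _ ⟨_, ⟨g, rfl⟩, rfl⟩
      simp only [(hρm q).map_smul, hρ1]
      exact hN.prop.smul_mem g q hq
    exact hsub ⟨p, rfl⟩
  obtain ⟨e, heN, he⟩ := exists_idempotent_in_compact_subsemigroup
    (fun r : S => (hρm r).continuous) N hN.prop.nonempty hN.prop.isClosed.isCompact
    (fun p _ q hq => hmem p q hq)
  -- By minimality every `q ∈ N` has the form `p * e`, and right multiplication by the idempotent
  -- `e` fixes such elements.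
  refine ⟨hN.prop.toSubMulAction, hN, ρ e, hρm e, fun q => hmem q e heN, fun q hq => ?_⟩
  have hsub : IsSubflow G (ρ e '' N) := by
    refine ⟨hN.prop.nonempty.image _,
      (hN.prop.isClosed.isCompact.image (hρm e).continuous).isClosed, ?_⟩
    rintro g _ ⟨z, hz, rfl⟩
    exact ⟨g • z, hN.prop.smul_mem g z hz, (hρm e).map_smul g z⟩
  obtain ⟨p, -, rfl⟩ := hN.le_of_le hsub (by rintro _ ⟨z, -, rfl⟩; exact hmem z e heN) hq
  exact (mul_assoc p e e).trans (congrArg (p * ·) he)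

end Samuel

/-- A `G`-map of a minimal flow to a retract of the Samuel compactification is injective. -/
theorem injective_of_retraction {G : Type u} [Group G] [TopologicalSpace G]
    [IsTopologicalGroup G] {N : SubMulAction G (Samuel (⊥ : Subgroup G))}
    {r : Samuel (⊥ : Subgroup G) → Samuel (⊥ : Subgroup G)} (hr : IsGMap G r)
    (hrN : ∀ q, r q ∈ N) (hrid : ∀ q ∈ N, r q = q)
    (hN : IsClosed (N : Set (Samuel (⊥ : Subgroup G))))
    [MulAction.IsMinimal G N] {P : Type*} [TopologicalSpace P] [CompactSpace P] [T2Space P]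
    [MulAction G P] [ContinuousSMul G P] [MulAction.IsMinimal G P] {π : P → N}
    (hπ : IsGMap G π) : Function.Injective π := by
  rcases isEmpty_or_nonempty P with hP | hP
  · exact fun a => hP.elim a
  have : CompactSpace N := isCompact_iff_compactSpace.1 hN.isCompact
  have : Nonempty N := hP.map π
  obtain ⟨p, hp⟩ := hπ.surjective_of_isMinimal ⟨r (Samuel.of ⊥ (1 : G)), hrN _⟩
  obtain ⟨ψ, hψ, hψ1⟩ := Samuel.exists_gMap (H := ⊥) p (G := G) bot_le
  -- As `r` is the identity on `N`, this makes `ψ` restricted to `N` a right inverse of `π`; it is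
  -- onto `P` by minimality.
  have hcomp : (Subtype.val ∘ π) ∘ ψ = r :=
    Samuel.gMap_ext ((N.isGMap_subtype.comp hπ).comp hψ) hr (by
      rw [Function.comp, hψ1, Function.comp, hp])
  have hsurj := (hψ.comp N.isGMap_subtype).surjective_of_isMinimal
  intro a b hab
  obtain ⟨a, rfl⟩ := hsurj a
  obtain ⟨b, rfl⟩ := hsurj b
  have ha := congrFun hcomp a
  have hb := congrFun hcomp b
  rw [hrid _ a.2] at ha
  rw [hrid _ b.2] at hb
  have : (a : Samuel (⊥ : Subgroup G)) = b := by
    rw [← ha, ← hb]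
    exact congrArg Subtype.val hab
  rw [Subtype.ext this]

/-- A `G`-map of a minimal flow to the universal minimal flow is injective. -/
theorem IsUniversalMinimalFlow.injective {G : Type u} [Group G] [TopologicalSpace G]
    [IsTopologicalGroup G] {M : Type m} [TopologicalSpace M] [CompactSpace M] [T2Space M]
    [MulAction G M] [ContinuousSMul G M] (hM : IsUniversalMinimalFlow G M)
    {P : Type*} [TopologicalSpace P] [CompactSpace P] [T2Space P]
    [MulAction G P] [ContinuousSMul G P] [MulAction.IsMinimal G P] {π : P → M}
    (hπ : IsGMap G π) : Function.Injective π := by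
  obtain ⟨N, hN, r, hr, hrN, hrid⟩ := Samuel.exists_minimal_retraction G
  have := isMinimal_of_minimal_isSubflow hN
  have := N.continuousSMul
  have : CompactSpace N := isCompact_iff_compactSpace.1 hN.prop.isClosed.isCompact
  have : Nonempty N := hN.prop.nonempty.to_subtype
  obtain ⟨f, hf⟩ := hM.universal N
  exact (injective_of_retraction hr hrN hrid hN.prop.isClosed
    (hf.toIsGMap.comp hπ)).of_comp

/-! ### Extreme amenability from fixed points in the Samuel compactification. -/

namespace Samuel

variable {G : Type u} [Group G] [TopologicalSpace G] [IsTopologicalGroup G]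

/-- Uniformly separated subsets of a metrizable group have disjoint closures in its Samuel
compactification. -/
theorem disjoint_closure_of_separated [FirstCountableTopology G] {A B U : Set G}
    (hU : U ∈ 𝓝 (1 : G)) (hAB : ∀ u ∈ U, ∀ a ∈ A, u * a ∉ B) :
    Disjoint (closure ((fun g : G => of (⊥ : Subgroup G) g) '' A))
      (closure ((fun g : G => of (⊥ : Subgroup G) g) '' B)) := by
  rcases A.eq_empty_or_nonempty with rfl | hA
  · simp
  let _ : UniformSpace G := IsTopologicalGroup.rightUniformSpace G
  have hunif : uniformity G = Filter.comap (fun p : G × G => p.2 * p.1⁻¹) (𝓝 1) := rfl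
  have : (uniformity G).IsCountablyGenerated := by rw [hunif]; infer_instance
  let _ : PseudoMetricSpace G := UniformSpace.pseudoMetricSpace G
  have hnear : ∀ ε > 0, ∃ V ∈ 𝓝 (1 : G), ∀ v ∈ V, ∀ g : G, dist g (v * g) < ε := by
    intro ε hε
    have := Metric.dist_mem_uniformity (α := G) hε
    rw [hunif] at this
    obtain ⟨V, hV, hVs⟩ := this
    exact ⟨V, hV, fun v hv g => @hVs (g, v * g) (by simpa using hv)⟩
  obtain ⟨δ, hδ, hδU⟩ : ∃ δ > 0, ∀ a b : G, dist a b < δ → b * a⁻¹ ∈ U := by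
    have : (fun p : G × G => p.2 * p.1⁻¹) ⁻¹' U ∈ uniformity G := by
      rw [hunif]; exact Filter.preimage_mem_comap hU
    obtain ⟨δ, hδ, h⟩ := Metric.mem_uniformity_dist.1 this
    exact ⟨δ, hδ, fun a b hab => h hab⟩
  -- Truncating the distance to `A` at `δ` makes it bounded, and constantly `δ` on `B`; being
  -- Lipschitz, it is right uniformly continuous.
  let F : G → ℝ := fun g => min (Metric.infDist g A) δ
  have hFlip : ∀ g h, |F g - F h| ≤ dist g h := fun g h =>
    (abs_min_sub_min_le_max _ _ _ _).trans (by
      simpa [Real.dist_eq] using (Metric.lipschitz_infDist_pt A).dist_le_mul g h)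
  have hF0 : ∀ g, 0 ≤ F g := fun g => le_min Metric.infDist_nonneg hδ.le
  let f : RUC (⊥ : Subgroup G) := ⟨BoundedContinuousFunction.ofNormedAddCommGroup
    (fun q => ((F (QuotientGroup.quotientBot q) : ℝ) : ℂ))
    (isQuotientMap_quotient_mk'.continuous_iff.2 (Complex.continuous_ofReal.comp
      ((Metric.continuous_infDist_pt A).min continuous_const))) δ (fun q => by
        rw [Complex.norm_real, Real.norm_of_nonneg (hF0 _)]
        exact min_le_right _ _), fun ε hε => by
      obtain ⟨V, hV, h⟩ := hnear ε hε
      refine ⟨V, hV, fun v hv q => ?_⟩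
      induction q using QuotientGroup.induction_on with
      | H g =>
        change ‖((F (v * g) : ℝ) : ℂ) - ((F g : ℝ) : ℂ)‖ < ε
        rw [← Complex.ofReal_sub, Complex.norm_real, Real.norm_eq_abs]
        exact (hFlip _ _).trans_lt (by rw [dist_comm]; exact h v hv g)⟩
  have hfA : ∀ χ ∈ closure ((fun g : G => of (⊥ : Subgroup G) g) '' A), eval f χ = 0 := by
    refine fun χ hχ => closure_minimal ?_
      (isClosed_singleton.preimage (continuous_eval f)) hχ
    rintro _ ⟨a, ha, rfl⟩
    change ((F a : ℝ) : ℂ) = 0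
    simp [F, Metric.infDist_zero_of_mem ha, hδ.le]
  have hfB : ∀ χ ∈ closure ((fun g : G => of (⊥ : Subgroup G) g) '' B),
      eval f χ = (δ : ℂ) := by
    refine fun χ hχ => closure_minimal ?_
      (isClosed_singleton.preimage (continuous_eval f)) hχ
    rintro _ ⟨b, hb, rfl⟩
    change ((F b : ℝ) : ℂ) = (δ : ℂ)
    rw [Complex.ofReal_inj]
    refine min_eq_right ((Metric.le_infDist hA).2 fun {a} ha => ?_)
    by_contra! hlt
    refine hAB _ (hδU a b (by rwa [dist_comm])) a ha ?_
    simpa using hb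
  refine Set.disjoint_left.2 fun χ h1 h2 => ?_
  have := (hfA χ h1).symm.trans (hfB χ h2)
  exact hδ.ne (by exact_mod_cast this)

/-- A subgroup that fixes a point in its closure in the Samuel compactification of the group is
extremely amenable. -/
theorem extremelyAmenable_of_fixed [FirstCountableTopology G] {K : Subgroup G}
    {q : Samuel (⊥ : Subgroup G)}
    (hq : q ∈ closure ((fun g : G => of (⊥ : Subgroup G) g) '' (K : Set G)))
    (hfix : ∀ k ∈ K, k • q = q) : ExtremelyAmenable K := by
  intro Y _ _ _ _ _ _
  inhabit Y
  let j : K → Samuel (⊥ : Subgroup G) := fun k => of ⊥ ((k : G) : G ⧸ (⊥ : Subgroup G))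
  have hne : (Filter.comap j (𝓝 q)).NeBot := by
    rw [Filter.comap_neBot_iff_frequently, ← mem_closure_iff_frequently]
    refine closure_mono ?_ hq
    rintro _ ⟨k, hk, rfl⟩
    exact ⟨⟨k, hk⟩, rfl⟩
  let F : Ultrafilter K := Ultrafilter.of (Filter.comap j (𝓝 q))
  have hj : Filter.Tendsto j F (𝓝 q) :=
    Filter.tendsto_comap.mono_left (Ultrafilter.of_le _)
  obtain ⟨y, -, hy⟩ := isCompact_univ.ultrafilter_le_nhds
    (F.map fun k => k • (default : Y)) (by simp)
  have hy : Filter.Tendsto (fun k : K => k • (default : Y)) F (𝓝 y) := hy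
  refine ⟨y, fun k => ?_⟩
  -- If `k` moves the limit `y`, a function `f` separates `y` from `k • y`. Then `q` and `k • q` lie
  -- in the closures of two uniformly separated subsets of `K`, contradicting `k • q = q`.
  by_contra hne
  obtain ⟨f, hf0, hf1, -⟩ := exists_continuous_zero_one_of_isClosed
    (isClosed_singleton (x := y)) (isClosed_singleton (x := k • y))
    (Set.disjoint_singleton.2 (Ne.symm hne))
  have hf0 : f y = 0 := hf0 rfl
  have hf1 : f (k • y) = 1 := hf1 rfl
  obtain ⟨U, hU, hfU⟩ := exists_nhds_one_norm_smul_sub_lt (G := K) f.continuous one_half_pos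
  obtain ⟨W, hW, hWU⟩ := mem_nhds_subtype _ _ _ |>.1 hU
  have hA : ∀ᶠ h : K in F, f (h • (default : Y)) < 1 / 4 :=
    ((f.continuous.tendsto y).comp hy).eventually
      (gt_mem_nhds (by rw [hf0]; norm_num : f y < 1 / 4))
  have hB : ∀ᶠ h : K in F, 3 / 4 < f ((k * h) • (default : Y)) := by
    simp only [mul_smul]
    exact ((f.continuous.tendsto (k • y)).comp (hy.const_smul k)).eventually
      (lt_mem_nhds (by rw [hf1]; norm_num : 3 / 4 < f (k • y)))
  -- An element carrying a point of one set into the other is a quotient of elements of `K`, so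
  -- separation within `K` is separation within `G`.
  have hdis := disjoint_closure_of_separated (G := G)
    (A := Subtype.val '' {h : K | f (h • (default : Y)) < 1 / 4})
    (B := Subtype.val '' {h : K | 3 / 4 < f (h • (default : Y))}) hW (by
      rintro u hu _ ⟨a, ha, rfl⟩ ⟨b, hb, hab⟩
      have hub : u = ((b * a⁻¹ : K) : G) := by
        rw [Subgroup.coe_mul, Subgroup.coe_inv, hab, mul_inv_cancel_right]
      have h1 := hfU (b * a⁻¹) (hWU (by rwa [Set.mem_preimage, ← hub])) (a • (default : Y))
      rw [smul_smul, inv_mul_cancel_right, Real.norm_eq_abs] at h1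
      have h2 := le_abs_self (f (b • (default : Y)) - f (a • (default : Y)))
      simp only [Set.mem_ofPred_eq] at ha hb
      linarith)
  refine Set.disjoint_left.1 hdis
    (mem_closure_of_tendsto hj (hA.mono fun h hh => ⟨h, ⟨h, hh, rfl⟩, rfl⟩)) ?_
  rw [← hfix k k.2]
  refine mem_closure_of_tendsto (hj.const_smul (k : G)) (hB.mono fun h hh =>
    ⟨((k * h : K) : G), ⟨k * h, hh, rfl⟩, ?_⟩)
  rfl

end Samuel

/-- An extremely amenable group fixes a point in the orbit closure of every point of a flow, in
any universe, over a given fixed point. -/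
theorem ExtremelyAmenable.exists_fixed_over {K : Type u} [Group K] [TopologicalSpace K]
    [IsTopologicalGroup K] (hK : ExtremelyAmenable K) {Z : Type w} [TopologicalSpace Z]
    [CompactSpace Z] [T2Space Z] [MulAction K Z] [ContinuousSMul K Z] {X : Type v}
    [TopologicalSpace X] [T2Space X] [MulAction K X] {π : Z → X} (hπ : IsGMap K π)
    {z : Z} (hz : ∀ k : K, k • π z = π z) :
    ∃ z₀, π z₀ = π z ∧ ∀ k : K, k • z₀ = z₀ := by
  -- The fixed point is found in `Sa(K)`, which lives in the universe of `K`, and is then pushed to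
  -- `Z`.
  obtain ⟨q, hq⟩ := hK (Samuel (⊥ : Subgroup K))
  obtain ⟨Φ, hΦ, hΦ1⟩ := Samuel.exists_gMap (H := (⊥ : Subgroup K)) z bot_le
  have hconst : IsGMap K fun _ : Samuel (⊥ : Subgroup K) => π z :=
    ⟨continuous_const, fun k _ => (hz k).symm⟩
  have h := Samuel.gMap_ext (hπ.comp hΦ) hconst (by rw [Function.comp, hΦ1])
  exact ⟨Φ q, congrFun h q, fun k => by rw [← hΦ.map_smul, hq k]⟩

theorem isClosed_stabilizer_of_continuousSMul {G X : Type*} [Group G] [TopologicalSpace G]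
    [TopologicalSpace X] [T1Space X] [MulAction G X] [ContinuousSMul G X] (x : X) :
    IsClosed (stabilizer G x : Set G) :=
  isClosed_singleton.preimage (continuous_id.smul (continuous_const (y := x)))

/-! ### Universal minimal flows with a comeager orbit. -/

section UniversalMinimalFlow

variable {H : Type u} [Group H] [TopologicalSpace H] [IsTopologicalGroup H]
  {M : Type m} [TopologicalSpace M] [CompactSpace M] [T2Space M]
  [MulAction H M] [ContinuousSMul H M]

/-- The fibre over `p` is the closure of a single coset, hence one point. A nonempty closed
invariant set maps onto `M`, so it contains this point, whose orbit is dense. -/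
theorem isMinimal_samuel_stabilizer [PolishSpace H] [MulAction.IsMinimal H M] {p : M}
    (hp : orbit H p ∈ residual M) : MulAction.IsMinimal H (Samuel (stabilizer H p)) := by
  obtain ⟨c, hc, hc1⟩ := Samuel.exists_gMap (H := stabilizer H p) p le_rfl
  refine (isMinimal_iff_isClosed_smul_invariant H).2 fun s hs hinv => ?_
  rcases s.eq_empty_or_nonempty with rfl | hne
  · exact Or.inl rfl
  have hinv' : ∀ (g : H), ∀ z ∈ s, g • z ∈ s := fun g z hz => hinv g ⟨z, hz, rfl⟩
  have himg : c '' s = Set.univ :=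
    (eq_empty_or_univ_of_smul_invariant_closed H
      (hs.isCompact.image hc.continuous).isClosed (by
        rintro g _ ⟨_, ⟨z, hz, rfl⟩, rfl⟩
        exact ⟨g • z, hinv' g z hz, hc.map_smul g z⟩)).resolve_left (hne.image c).ne_empty
  obtain ⟨z, hz, hzp⟩ : p ∈ c '' s := himg ▸ Set.mem_univ p
  have hz1 : z = Samuel.of (stabilizer H p) (1 : H) := by
    have hsub : (fun g : H => Samuel.of (stabilizer H p) g) '' (stabilizer H p : Set H) ⊆
        {Samuel.of (stabilizer H p) (1 : H)} := by
      rintro _ ⟨g, hg, rfl⟩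
      exact congrArg _ (QuotientGroup.eq.2 (by simpa using hg))
    exact closure_minimal hsub isClosed_singleton
      (Samuel.mem_closure_of_apply_eq hp hc hc1 hzp)
  refine Or.inr (Set.univ_subset_iff.1 ?_)
  rw [← (Samuel.dense_orbit_of (H := stabilizer H p)).closure_eq]
  refine closure_minimal ?_ hs
  rintro _ ⟨g, rfl⟩
  exact hinv' g _ (hz1 ▸ hz)

/-- If the universal minimal flow has a comeager orbit, it is the Samuel compactification of the
quotient by a point stabilizer. -/
theorem IsUniversalMinimalFlow.flowIsomorphic_samuel [PolishSpace H]
    (hM : IsUniversalMinimalFlow H M) {p : M} (hp : orbit H p ∈ residual M) :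
    FlowIsomorphic H M (Samuel (stabilizer H p)) := by
  have := hM.isMinimal
  have := isMinimal_samuel_stabilizer hp
  obtain ⟨c, hc, -⟩ := Samuel.exists_gMap (H := stabilizer H p) p le_rfl
  let e := Equiv.ofBijective c ⟨hM.injective hc, hc.surjective_of_isMinimal⟩
  have he : Continuous e := hc.continuous
  refine ⟨e.symm, ⟨he.continuous_symm_of_equiv_compact_to_t2, fun g x => ?_⟩, e.symm.bijective⟩
  rw [Equiv.symm_apply_eq]
  exact (congrArg (g • ·) (e.apply_symm_apply x)).symm.trans (hc.map_smul g (e.symm x)).symm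

/-- If the universal minimal flow has a comeager orbit, the stabilizers of the points of this
orbit are extremely amenable. -/
theorem IsUniversalMinimalFlow.extremelyAmenable_stabilizer [PolishSpace H]
    (hM : IsUniversalMinimalFlow H M) {p : M} (hp : orbit H p ∈ residual M) :
    ExtremelyAmenable (stabilizer H p) := by
  have := hM.isMinimal
  obtain ⟨N, hN, -⟩ := Samuel.exists_minimal_retraction H
  have := isMinimal_of_minimal_isSubflow hN
  have := N.continuousSMul
  have : CompactSpace N := isCompact_iff_compactSpace.1 hN.prop.isClosed.isCompact
  have : Nonempty N := hN.prop.nonempty.to_subtype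
  obtain ⟨c, hc, hc1⟩ := Samuel.exists_gMap (H := (⊥ : Subgroup H)) p bot_le
  have hcN := hc.comp N.isGMap_subtype
  obtain ⟨q, hq⟩ := hcN.surjective_of_isMinimal p
  -- For `k` fixing `p`, both `k • q` and `q` lie over `p` in the minimal flow `N`, on which the map
  -- to `M` is injective.
  refine Samuel.extremelyAmenable_of_fixed (Samuel.mem_closure_of_apply_eq hp hc hc1 hq)
    fun k hk => congrArg Subtype.val (hM.injective hcN (a₁ := k • q) (a₂ := q) ?_)
  rw [hcN.map_smul, hq, mem_stabilizer_iff.1 hk]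

end UniversalMinimalFlow

theorem FlowIsomorphic.isMinimal {G X Y : Type*} [Group G] [TopologicalSpace X] [MulAction G X]
    [TopologicalSpace Y] [MulAction G Y] (h : FlowIsomorphic G X Y)
    (hX : MulAction.IsMinimal G X) : MulAction.IsMinimal G Y := by
  obtain ⟨f, hf, hb⟩ := h
  refine ⟨fun y => ?_⟩
  obtain ⟨x, rfl⟩ := hb.2 y
  refine (hb.2.denseRange.dense_image hf.continuous (MulAction.dense_orbit G x)).mono ?_
  rintro _ ⟨_, ⟨g, rfl⟩, rfl⟩
  exact ⟨g, (hf.map_smul g x).symm⟩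

theorem map_subtype_le_stabilizer {G X : Type*} [Group G] [MulAction G X] {x : X}
    (K : Subgroup (stabilizer G x)) :
    K.map (stabilizer G x).subtype ≤ stabilizer G x := by
  rintro _ ⟨k, -, rfl⟩
  exact k.2

/-! ### The projective cover. -/

section Cover

variable {G : Type u} [Group G] [TopologicalSpace G] [IsTopologicalGroup G]
  {X : Type v} [TopologicalSpace X] [T2Space X] [MulAction G X] {x : X}

/-- If the Samuel compactification of `stabilizer G x ⧸ K` is minimal then that of `G ⧸ K` is
an irreducible extension. -/
theorem isGIrreducible_samuel [PolishSpace G] [CompactSpace X] [ContinuousSMul G X]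
    (hx : orbit G x ∈ residual X)
    (K : Subgroup (stabilizer G x)) (hK : MulAction.IsMinimal (stabilizer G x) (Samuel K))
    {φ : Samuel (K.map (stabilizer G x).subtype) → X} (hφ : IsGMap G φ)
    (hφ1 : φ (Samuel.of _ (1 : G)) = x) : IsGIrreducible G φ := by
  have hsurj : Function.Surjective φ := by
    have hd : DenseRange φ := (dense_of_mem_residual hx).mono (by
      rintro _ ⟨g, rfl⟩
      exact ⟨g • Samuel.of _ (1 : G), by rw [hφ.map_smul, hφ1]⟩)
    rw [← Set.range_eq_univ, ← (isCompact_range hφ.continuous).isClosed.closure_eq,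
      hd.closure_eq]
  refine ⟨⟨hφ, hsurj⟩, fun Z hZ hne himg => hne (Set.univ_subset_iff.1 ?_)⟩
  obtain ⟨z, hz, hzx⟩ : x ∈ φ '' Z := himg ▸ Set.mem_univ x
  -- The canonical map `Sa(H/K) → Sa(G/K)`; its compact image contains the cosets of elements of
  -- `H`, hence the fibre over `x`.
  obtain ⟨j, hj, hj1⟩ := Samuel.exists_gMap (G := stabilizer G x) (H := K)
    (Samuel.of (K.map (stabilizer G x).subtype) (1 : G)) (fun k hk => by
      change (k : G) • Samuel.of (K.map (stabilizer G x).subtype) (1 : G) = _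
      rw [Samuel.smul_of]
      refine congrArg _ (QuotientGroup.eq (a := ((k : G) * 1 : G)).2 ?_)
      simpa using hk)
  have hzj : z ∈ Set.range j := by
    refine closure_minimal ?_ (isCompact_range hj.continuous).isClosed
      (Samuel.mem_closure_of_apply_eq hx hφ hφ1 hzx)
    rintro _ ⟨g, hg, rfl⟩
    refine ⟨(⟨g, hg⟩ : stabilizer G x) • Samuel.of K (1 : stabilizer G x), ?_⟩
    rw [hj.map_smul, hj1]
    change g • Samuel.of (K.map (stabilizer G x).subtype) (1 : G) = _
    rw [Samuel.smul_of]
    exact congrArg (fun a : G => Samuel.of (K.map (stabilizer G x).subtype) a) (mul_one g)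
  obtain ⟨z, rfl⟩ := hzj
  have h1 : Samuel.of (K.map (stabilizer G x).subtype) (1 : G) ∈ Z := by
    have hsub : closure (orbit (stabilizer G x) z) ⊆ j ⁻¹' Z := by
      refine closure_minimal ?_ (hZ.isClosed.preimage hj.continuous)
      rintro _ ⟨g, rfl⟩
      rw [Set.mem_preimage, hj.map_smul]
      exact hZ.smul_mem g _ hz
    rw [(MulAction.dense_orbit (stabilizer G x) z).closure_eq] at hsub
    exact hj1 ▸ hsub (Set.mem_univ (Samuel.of K (1 : stabilizer G x)))
  rw [← (Samuel.dense_orbit_of (H := K.map (stabilizer G x).subtype)).closure_eq]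
  refine closure_minimal ?_ hZ.isClosed
  rintro _ ⟨g, rfl⟩
  exact hZ.smul_mem g _ h1

/-- If `K` is extremely amenable, the Samuel compactification of `G ⧸ K` lifts to every extension
of `X`. -/
theorem exists_lift_samuel {K : Subgroup (stabilizer G x)} (hK : ExtremelyAmenable K)
    {φ : Samuel (K.map (stabilizer G x).subtype) → X} (hφ : IsGMap G φ)
    (hφ1 : φ (Samuel.of _ (1 : G)) = x) {Z : Type w} [TopologicalSpace Z] [CompactSpace Z]
    [T2Space Z] [MulAction G Z] [ContinuousSMul G Z] {π : Z → X} (hπ : IsGExtension G π) :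
    ∃ ψ : Samuel (K.map (stabilizer G x).subtype) → Z, IsGMap G ψ ∧ π ∘ ψ = φ := by
  obtain ⟨z, hz⟩ := hπ.surjective x
  obtain ⟨z₀, hz₀, hfix⟩ := hK.exists_fixed_over
    ((hπ.toIsGMap.restrict (stabilizer G x)).restrict K) (z := z) (fun k => by
      rw [hz]
      exact k.1.2)
  obtain ⟨ψ, hψ, hψ1⟩ := Samuel.exists_gMap (H := K.map (stabilizer G x).subtype) z₀ (by
    rintro _ ⟨k, hk, rfl⟩
    exact hfix ⟨k, hk⟩)
  refine ⟨ψ, hψ, Samuel.gMap_ext (hπ.toIsGMap.comp hψ) hφ ?_⟩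
  rw [Function.comp, hψ1, hz₀, hz, hφ1]

end Cover

end

theorem mainTheorem6 (G : Type u) [Group G] [TopologicalSpace G] [IsTopologicalGroup G]
    [PolishSpace G]
    (X : Type v) [TopologicalSpace X] [CompactSpace X] [T2Space X] [MulAction G X]
    [ContinuousSMul G X]
    (x : X) (hx : orbit G x ∈ residual X)
    (M : Type m) [TopologicalSpace M] [CompactSpace M] [T2Space M]
    [MulAction (stabilizer G x) M] [ContinuousSMul (stabilizer G x) M]
    (hM : IsUniversalMinimalFlow (stabilizer G x) M)
    (hMc : ∃ p : M, orbit (stabilizer G x) p ∈ residual M) :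
    (∃ K : Subgroup (stabilizer G x), IsClosed (K : Set (stabilizer G x)) ∧
      ExtremelyAmenable K ∧ FlowIsomorphic (stabilizer G x) M (Samuel K)) ∧
    ∀ K : Subgroup (stabilizer G x), IsClosed (K : Set (stabilizer G x)) →
      ExtremelyAmenable K → FlowIsomorphic (stabilizer G x) M (Samuel K) →
      ∃ φ : Samuel (K.map (stabilizer G x).subtype) → X,
        IsGProjectiveCover.{u, v, u, w} G φ := by
  have : PolishSpace (stabilizer G x) :=
    (isClosed_stabilizer_of_continuousSMul (G := G) x).polishSpace
  refine ⟨?_, fun K _ hK hiso => ?_⟩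
  · obtain ⟨p, hp⟩ := hMc
    exact ⟨stabilizer _ p, isClosed_stabilizer_of_continuousSMul p,
      hM.extremelyAmenable_stabilizer hp, hM.flowIsomorphic_samuel hp⟩
  · obtain ⟨φ, hφ, hφ1⟩ := Samuel.exists_gMap x (map_subtype_le_stabilizer K)
    exact ⟨φ, isGIrreducible_samuel hx K (hiso.isMinimal hM.isMinimal) hφ hφ1,
      fun Z _ _ _ _ _ π hπ => exists_lift_samuel hK hφ hφ1 hπ.toIsGExtension⟩
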